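/- Let $(X,d)$ be a locally compact second-countable metric space and $\mu$ a finite Borel measure on $X$ that is Ahlfors $\delta$-regular for some $\delta>0$: there is $C\ge 1$ with $C^{-1}r^{\delta}\le \mu(\overline{B}(x,r))\le C r^{\delta}$ for all $x\in X$ and $0\le r<\operatorname{diam}X$. On the real Hilbert space $L^2(X,\mu)$ let $\operatorname{Dom}\mathcal E$ be the space of all $f$ with $\iint \frac{|f(x)-f(y)|^2}{d(x,y)^{\delta}}\,d\mu(y)\,d\mu(x)<\infty$, and for $f,g\in\operatorname{Dom}\mathcal E$ put $$\mathcal E(f,g)=\frac12\iint\frac{(f(x)-f(y))(g(x)-g(y))}{d(x,y)^{\delta}}\,d\mu(y)\,d\mu(x),$$ both integrals being taken over $X\times X$ minus the diagonal. Let $\Delta$ (the logarithmic Dirichlet Laplacian) be the self-adjoint operator associated with $\mathcal E$: $u\in\operatorname{Dom}\Delta$ and $\Delta u=v$ if and only if $u\in\operatorname{Dom}\mathcal E$, $v\in L^2(X,\mu)$ and $\mathcal E(u,g)=\langle v,g\rangle_{L^2}$ for all $g\in\operatorname{Dom}\mathcal E$. For $0<\alpha\le 1$ let $\textup{Höl}_{<\alpha}(X,d)$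 be the set of bounded uniformly continuous functions $f:X\to\mathbb R$ that are $\beta$-Hölder for every $0<\beta<\alpha$. Functions are identified with their classes in $L^2(X,\mu)$. Then for every $0<\alpha\le 1$: 1. $\textup{Höl}_{<\alpha}(X,d)\subset\operatorname{Dom}\Delta$ and $\Delta(\textup{Höl}_{<\alpha}(X,d))\subset\textup{Höl}_{<\alpha}(X,d)$; 2. hence $\textup{Höl}_{<\alpha}(X,d)\subset C^\infty(\Delta):=\bigcap_{n\ge 1}\operatorname{Dom}(\Delta^n)$; 3. in particular every $\alpha$-Hölder continuous function $f:X\to\mathbb R$ belongs to $C^\infty(\Delta)$. -/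

import Mathlib

open MeasureTheory Set
open scoped ENNReal NNReal

set_option linter.unusedSectionVars false

noncomputable section

namespace LogLaplacian

/-! ### Ahlfors regularity -/

/-- `μ` is Ahlfors `δ`-regular: `C⁻¹ r^δ ≤ μ (closedBall x r) ≤ C r^δ` for all `x` and all
`0 ≤ r < diam X`.  (`Metric.ediam` is the diameter with values in `[0, ∞]`, so that nothing is
lost when the space is unbounded.) -/
def IsAhlforsRegular {X : Type*} [MetricSpace X] [MeasurableSpace X] (μ : Measure X) (δ : ℝ) :
    Prop :=
  ∃ C : ℝ, 1 ≤ C ∧ ∀ (x : X) (r : ℝ), 0 ≤ r → ENNReal.ofReal r < Metric.ediam (univ : Set X) →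
    ENNReal.ofReal (C⁻¹ * r ^ δ) ≤ μ (Metric.closedBall x r) ∧
      μ (Metric.closedBall x r) ≤ ENNReal.ofReal (C * r ^ δ)

/-! ### The operator associated with a bilinear form, powers, smooth vectors -/

section Forms

variable {H : Type*} [NormedAddCommGroup H] [InnerProductSpace ℝ H]

/-- The graph of the operator associated with a bilinear form `Q` with domain `D`: all pairs
`(u, v)` with `u ∈ D` and `Q(u, g) = ⟪v, g⟫` for every `g ∈ D`. Writing `f = u + v`, this says
`⟪u, g⟫ + Q(u, g) = ⟪f, g⟫` for all `g ∈ D`, that is `u = R f` and `v = f - R f`, where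
`R = (1 + A)⁻¹` is the Riesz operator of the form. -/
def formGraph (D : Submodule ℝ H) (Q : D →ₗ[ℝ] D →ₗ[ℝ] ℝ) : Submodule ℝ (H × H) where
  carrier := {p | ∃ u : D, (u : H) = p.1 ∧ ∀ g : D, Q u g = inner ℝ p.2 (g : H)}
  zero_mem' := ⟨0, by simp⟩
  add_mem' := by
    rintro p q ⟨u, hu, hu'⟩ ⟨v, hv, hv'⟩
    exact ⟨u + v, by simp [hu, hv], fun g => by simp [hu', hv', inner_add_left]⟩
  smul_mem' := by
    rintro c p ⟨u, hu, hu'⟩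
    exact ⟨c • u, by simp [hu], fun g => by simp [hu', real_inner_smul_left]⟩

/-- The (unbounded) operator associated with a densely defined bilinear form. -/
def formOperator (D : Submodule ℝ H) (Q : D →ₗ[ℝ] D →ₗ[ℝ] ℝ) : H →ₗ.[ℝ] H :=
  (formGraph D Q).toLinearPMap

/-- For a densely defined form, `formGraph` is the graph of `formOperator`. -/
theorem formOperator_graph (D : Submodule ℝ H) (Q : D →ₗ[ℝ] D →ₗ[ℝ] ℝ)
    (hD : Dense (D : Set H)) : (formOperator D Q).graph = formGraph D Q := by
  refine Submodule.toLinearPMap_graph_eq _ ?_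
  rintro ⟨x, y⟩ ⟨u, hu, hu'⟩ hx
  simp only at hu hu' hx
  have h0 : u = 0 := Subtype.ext (hu.trans hx)
  subst h0
  refine hD.eq_zero_of_inner_left ℝ fun g hg => ?_
  have := hu' ⟨g, hg⟩
  simpa using this.symm

/-- `Dom (Aⁿ)`: `Dom (A⁰)` is everything, and `u ∈ Dom (Aⁿ⁺¹)` if and only if `u ∈ Dom A` and
`A u ∈ Dom (Aⁿ)`. -/
def powDomain (A : H →ₗ.[ℝ] H) : ℕ → Submodule ℝ H
  | 0 => ⊤
  | n + 1 => ((powDomain A n).comap A.toFun).map A.domain.subtype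

theorem mem_powDomain_succ (A : H →ₗ.[ℝ] H) (n : ℕ) (u : H) :
    u ∈ powDomain A (n + 1) ↔ ∃ h : u ∈ A.domain, A ⟨u, h⟩ ∈ powDomain A n := by
  simp only [powDomain, Submodule.mem_map, Submodule.mem_comap]
  constructor
  · rintro ⟨v, hv, rfl⟩
    exact ⟨v.2, hv⟩
  · rintro ⟨h, hv⟩
    exact ⟨⟨u, h⟩, hv, rfl⟩

/-- The `C^∞`-vectors of `A`, that is `⋂ₙ Dom (Aⁿ)` over `n ≥ 1`. -/
def smoothVectors (A : H →ₗ.[ℝ] H) : Submodule ℝ H :=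
  ⨅ (n : ℕ) (_ : 1 ≤ n), powDomain A n

end Forms

/-! ### The form and the logarithmic Dirichlet Laplacian -/

section Form

variable {X : Type*} [MetricSpace X] [MeasurableSpace X]

/-- The measure `μ × μ` on `X × X` minus the diagonal. -/
def offDiag (μ : Measure X) : Measure (X × X) := (μ.prod μ).restrict (diagonal X)ᶜ

/-- The square of the difference quotient integrated in the form. -/
def energyDensity (δ : ℝ) (f : X → ℝ) (p : X × X) : ℝ :=
  |f p.1 - f p.2| ^ 2 / dist p.1 p.2 ^ δ

/-- The integrand of the form. -/
def formIntegrand (δ : ℝ) (f g : X → ℝ) (p : X × X) : ℝ :=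
  (f p.1 - f p.2) * (g p.1 - g p.2) / dist p.1 p.2 ^ δ

lemma offDiag_ae {μ : Measure X} [SFinite μ] {p : X → Prop} (h : ∀ᵐ x ∂μ, p x) :
    ∀ᵐ q ∂(offDiag μ), p q.1 ∧ p q.2 := by
  refine ae_restrict_of_ae ?_
  exact (Measure.quasiMeasurePreserving_fst.ae h).and (Measure.quasiMeasurePreserving_snd.ae h)

variable [BorelSpace X] [SecondCountableTopology X]

lemma aestronglyMeasurable_formIntegrand (μ : Measure X) [SFinite μ] (δ : ℝ)
    (f g : Lp ℝ 2 μ) : AEStronglyMeasurable (formIntegrand δ f g) (offDiag μ) := by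
  have hf := (Lp.stronglyMeasurable f).measurable
  have hg := (Lp.stronglyMeasurable g).measurable
  have : Measurable (formIntegrand δ f g) := by
    unfold formIntegrand
    refine (((hf.comp measurable_fst).sub (hf.comp measurable_snd)).mul
      ((hg.comp measurable_fst).sub (hg.comp measurable_snd))).div ?_
    exact (measurable_dist).pow_const δ
  exact this.aestronglyMeasurable

lemma energyDensity_eq (δ : ℝ) (f : X → ℝ) : energyDensity δ f = formIntegrand δ f f := by
  ext p
  simp [energyDensity, formIntegrand, sq]

lemma energyDensity_nonneg (δ : ℝ) (f : X → ℝ) (p : X × X) : 0 ≤ energyDensity δ f p := by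
  unfold energyDensity
  positivity

lemma integrable_energyDensity {μ : Measure X} [SFinite μ] {δ : ℝ} {f : Lp ℝ 2 μ}
    (hf : ∫⁻ p, ENNReal.ofReal (energyDensity δ f p) ∂(offDiag μ) < ∞) :
    Integrable (energyDensity δ f) (offDiag μ) := by
  refine ⟨?_, ?_⟩
  · rw [energyDensity_eq]
    exact aestronglyMeasurable_formIntegrand μ δ f f
  · rw [hasFiniteIntegral_iff_ofReal (ae_of_all _ (energyDensity_nonneg δ f))]
    exact hf

/-- `Dom 𝓔`: the `f ∈ L²(X, μ)` with `∬ |f x - f y|² / d(x, y)^δ < ∞`. -/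
def formDomain (μ : Measure X) [SFinite μ] (δ : ℝ) : Submodule ℝ (Lp ℝ 2 μ) where
  carrier := {f | ∫⁻ p, ENNReal.ofReal (energyDensity δ f p) ∂(offDiag μ) < ∞}
  zero_mem' := by
    have h : ∀ᵐ p ∂(offDiag μ),
        ENNReal.ofReal (energyDensity δ (0 : Lp ℝ 2 μ) p) = (fun _ => 0) p := by
      filter_upwards [offDiag_ae (Lp.coeFn_zero ℝ 2 μ)] with p hp
      simp only [energyDensity]
      rw [hp.1, hp.2]
      simp
    have h' := lintegral_congr_ae h
    rw [lintegral_zero] at h'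
    exact lt_of_eq_of_lt h' ENNReal.zero_lt_top
  add_mem' := by
    intro f g hf hg
    have hi := ((integrable_energyDensity hf).add (integrable_energyDensity hg)).const_mul 2
    have hi' := hi.lintegral_lt_top
    refine lt_of_le_of_lt (lintegral_mono_ae ?_) hi'
    filter_upwards [offDiag_ae (Lp.coeFn_add f g)] with p hp
    refine ENNReal.ofReal_le_ofReal ?_
    simp only [energyDensity, sq_abs, Pi.add_apply]
    rw [hp.1, hp.2, ← add_div, ← mul_div_assoc]
    refine div_le_div_of_nonneg_right ?_ (Real.rpow_nonneg dist_nonneg _)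
    simp only [Pi.add_apply]
    nlinarith [sq_nonneg ((f p.1 - f p.2) - (g p.1 - g p.2))]
  smul_mem' := by
    intro c f hf
    have hi' := ((integrable_energyDensity hf).const_mul (c ^ 2)).lintegral_lt_top
    refine lt_of_le_of_lt (lintegral_mono_ae ?_) hi'
    filter_upwards [offDiag_ae (Lp.coeFn_smul c f)] with p hp
    refine ENNReal.ofReal_le_ofReal (le_of_eq ?_)
    simp only [energyDensity, sq_abs]
    rw [hp.1, hp.2]
    simp only [Pi.smul_apply, smul_eq_mul]
    ring

lemma integrable_formIntegrand {μ : Measure X} [SFinite μ] {δ : ℝ}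
    (f g : formDomain μ δ) :
    Integrable (formIntegrand δ (f : Lp ℝ 2 μ) (g : Lp ℝ 2 μ)) (offDiag μ) := by
  refine ((integrable_energyDensity f.2).add (integrable_energyDensity g.2)).mono'
    (aestronglyMeasurable_formIntegrand μ δ _ _) (ae_of_all _ fun p => ?_)
  have hd : 0 ≤ dist p.1 p.2 ^ δ := Real.rpow_nonneg dist_nonneg _
  simp only [formIntegrand, energyDensity, Pi.add_apply, Real.norm_eq_abs]
  rw [abs_div, abs_mul, abs_of_nonneg hd, ← add_div]
  refine div_le_div_of_nonneg_right ?_ hd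
  nlinarith [sq_nonneg (|(f : Lp ℝ 2 μ) p.1 - (f : Lp ℝ 2 μ) p.2| -
      |(g : Lp ℝ 2 μ) p.1 - (g : Lp ℝ 2 μ) p.2|),
    abs_nonneg ((f : Lp ℝ 2 μ) p.1 - (f : Lp ℝ 2 μ) p.2),
    abs_nonneg ((g : Lp ℝ 2 μ) p.1 - (g : Lp ℝ 2 μ) p.2)]

/-- `𝓔(f, g) = ½ ∬ (f x - f y) (g x - g y) / d(x, y)^δ`, integrated off the diagonal. -/
def energy (μ : Measure X) [SFinite μ] (δ : ℝ) (f g : Lp ℝ 2 μ) : ℝ :=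
  1 / 2 * ∫ p, formIntegrand δ f g p ∂(offDiag μ)

lemma energy_comm (μ : Measure X) [SFinite μ] (δ : ℝ) (f g : Lp ℝ 2 μ) :
    energy μ δ f g = energy μ δ g f := by
  simp only [energy, formIntegrand, mul_comm]

lemma energy_add_left {μ : Measure X} [SFinite μ] {δ : ℝ} (f f' g : formDomain μ δ) :
    energy μ δ ((f + f' : formDomain μ δ) : Lp ℝ 2 μ) g = energy μ δ f g + energy μ δ f' g := by
  unfold energy
  rw [← mul_add, ← integral_add (integrable_formIntegrand f g) (integrable_formIntegrand f' g)]
  congr 1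
  refine integral_congr_ae ?_
  filter_upwards [offDiag_ae (Lp.coeFn_add (f : Lp ℝ 2 μ) (f' : Lp ℝ 2 μ))] with p hp
  simp only [formIntegrand, Submodule.coe_add]
  rw [hp.1, hp.2]
  simp only [Pi.add_apply]
  ring

lemma energy_smul_left {μ : Measure X} [SFinite μ] {δ : ℝ} (c : ℝ) (f g : formDomain μ δ) :
    energy μ δ ((c • f : formDomain μ δ) : Lp ℝ 2 μ) g = c * energy μ δ f g := by
  unfold energy
  rw [mul_left_comm, ← integral_const_mul (μ := offDiag μ) c]
  congr 1
  refine integral_congr_ae ?_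
  filter_upwards [offDiag_ae (Lp.coeFn_smul c (f : Lp ℝ 2 μ))] with p hp
  simp only [formIntegrand, Submodule.coe_smul]
  rw [hp.1, hp.2]
  simp only [Pi.smul_apply, smul_eq_mul]
  ring

/-- The form `𝓔` as a bilinear map on `Dom 𝓔`. -/
def energyForm (μ : Measure X) [SFinite μ] (δ : ℝ) :
    formDomain μ δ →ₗ[ℝ] formDomain μ δ →ₗ[ℝ] ℝ :=
  LinearMap.mk₂ ℝ (fun f g => energy μ δ f g)
    energy_add_left
    energy_smul_left
    (fun f g g' => by
      simp only [energy_comm μ δ (f : Lp ℝ 2 μ)]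
      exact energy_add_left g g' f)
    (fun c f g => by
      simp only [energy_comm μ δ (f : Lp ℝ 2 μ)]
      exact energy_smul_left c g f)

/-- The logarithmic Dirichlet Laplacian `Δ`, an unbounded operator on the real Hilbert space
`L²(X, μ)`: the operator associated with the form `𝓔`. -/
def logLaplacian (μ : Measure X) [SFinite μ] (δ : ℝ) : Lp ℝ 2 μ →ₗ.[ℝ] Lp ℝ 2 μ :=
  formOperator (formDomain μ δ) (energyForm μ δ)

end Form

/-! ### Almost Hölder functions -/

/-- `f` is almost `α`-Hölder: it is bounded, uniformly continuous, and `β`-Hölder for every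
`0 < β < α`. -/
def IsAlmostHolder {X : Type*} [MetricSpace X] (α : ℝ) (f : X → ℝ) : Prop :=
  UniformContinuous f ∧ (∃ M : ℝ, ∀ x, |f x| ≤ M) ∧
    ∀ β : ℝ≥0, 0 < β → (β : ℝ) < α → MemHolder β f

end LogLaplacian

end

/-! On Hölder functions `Δ` is the singular integral `f ↦ ∫ (f x - f y) / d(x, y)^δ dμ(y)`, an
operator of order zero up to a logarithm: it costs only an arbitrarily small part of the Hölder
exponent. As `IsAlmostHolder` asks for all exponents strictly below `α`, the loss is invisible, the
class is invariant, and iteration gives smooth vectors.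

The measure enters through one fact, `HasBoundedPotentials`: `∫ d(x, y)^(ε - δ) dμ(y)` is bounded in
`x` for each `ε > 0`. Finiteness of `μ` and the lower Ahlfors bound make `X` bounded; the upper
bound and a dyadic decomposition then give the potentials. Boundedness also makes Hölder functions
almost Hölder.

Regularity of the singular integral follows by integrating the kernel estimate
`exists_abs_kernelDiff_sub_le`. It agrees with `Δ` because the form integrand symmetrizes and Fubini
applies (`energy_toLp_eq`), while density of the form domain makes the operator single-valued. -/

noncomputable section

namespace LogLaplacian

/-! ### Riesz potentials and the pointwise kernel estimate -/

section Potential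

variable {X : Type*} [MetricSpace X] [MeasurableSpace X] [BorelSpace X]

/-- On a bounded upper `δ`-regular space the Riesz potentials `∫ d(x, y)^(ε - δ) dμ(y)` with
`ε > 0` are bounded uniformly in `x`. -/
lemma exists_lintegral_dist_rpow_le {μ : Measure X} {C D δ ε : ℝ} (hδ : 0 < δ) (hC : 0 ≤ C)
    (hD : 0 < D) (hμ : ∀ (x : X) (r : ℝ), 0 ≤ r →
      μ (Metric.closedBall x r) ≤ ENNReal.ofReal (C * r ^ δ))
    (hdist : ∀ x y : X, dist x y ≤ D) (hε : 0 < ε) :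
    ∃ A : ℝ≥0, ∀ x : X, ∫⁻ y, ENNReal.ofReal (dist x y ^ (ε - δ)) ∂μ ≤ A := by
  have hq0 : (0 : ℝ) ≤ (1 / 2 : ℝ) ^ ε := by positivity
  have hq1 : (1 / 2 : ℝ) ^ ε < 1 := Real.rpow_lt_one (by norm_num) (by norm_num) hε
  -- An upper bound for `d^(ε - δ)` on the shell `D / 2^(n+1) < d ≤ D / 2^n`. Bounding `d^ε` and
  -- `d^(-δ)` at opposite ends avoids a case split on the sign of `ε - δ`. Against the ball's mass
  -- the powers `±δ` cancel, leaving ratio `2^(-ε)`.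
  let c : ℕ → ℝ := fun n => (D * (1 / 2) ^ n) ^ ε * (D * (1 / 2) ^ (n + 1)) ^ (-δ)
  have hc : ∀ n, 0 ≤ c n := fun n => by positivity
  have hcC : ∀ n, c n * (C * (D * (1 / 2) ^ n) ^ δ) =
      C * (1 / 2 : ℝ) ^ (-δ) * D ^ ε * ((1 / 2 : ℝ) ^ ε) ^ n := by
    intro n
    have h1 : D * (1 / 2 : ℝ) ^ (n + 1) = (D * (1 / 2) ^ n) * (1 / 2) := by ring
    have hr : 0 < D * (1 / 2 : ℝ) ^ n := by positivity
    have h2 : (D * (1 / 2 : ℝ) ^ n) ^ (-δ) * (D * (1 / 2) ^ n) ^ δ = 1 := by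
      rw [← Real.rpow_add hr]; simp
    have h3 : (D * (1 / 2 : ℝ) ^ n) ^ ε = D ^ ε * ((1 / 2 : ℝ) ^ ε) ^ n := by
      rw [Real.mul_rpow hD.le (by positivity), ← Real.rpow_natCast, ← Real.rpow_natCast,
        ← Real.rpow_mul (by norm_num), ← Real.rpow_mul (by norm_num), mul_comm (n : ℝ)]
    simp only [c]
    rw [h1, Real.mul_rpow hr.le (by norm_num)]
    linear_combination (C * (1 / 2 : ℝ) ^ (-δ) * (D * (1 / 2 : ℝ) ^ n) ^ ε) * h2 +
      (C * (1 / 2 : ℝ) ^ (-δ)) * h3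
  have hsum : Summable fun n : ℕ => C * (1 / 2 : ℝ) ^ (-δ) * D ^ ε * ((1 / 2 : ℝ) ^ ε) ^ n :=
    (summable_geometric_of_lt_one hq0 hq1).mul_left _
  refine ⟨Real.toNNReal (∑' n : ℕ, C * (1 / 2 : ℝ) ^ (-δ) * D ^ ε * ((1 / 2 : ℝ) ^ ε) ^ n),
    fun x => ?_⟩
  -- The mass bound at radius `0`. The centre lies in no dyadic shell, so it has to be null.
  have hx : μ {x} = 0 := by
    have := hμ x 0 le_rfl
    simpa [Real.zero_rpow hδ.ne'] using this
  have hpt : ∀ᵐ y ∂μ, ENNReal.ofReal (dist x y ^ (ε - δ)) ≤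
      ∑' n : ℕ, (Metric.closedBall x (D * (1 / 2) ^ n)).indicator
        (fun _ => ENNReal.ofReal (c n)) y := by
    have hne : ∀ᵐ y ∂μ, y ≠ x := by
      rw [ae_iff]; simpa using hx
    filter_upwards [hne] with y hy
    have hd : 0 < dist x y := dist_pos.2 hy.symm
    obtain ⟨n, hn1, hn2⟩ := exists_nat_pow_near_of_lt_one (x := dist x y / D) (y := (1 / 2 : ℝ))
      (div_pos hd hD) ((div_le_one hD).2 (hdist x y)) (by norm_num) (by norm_num)
    rw [lt_div_iff₀ hD, mul_comm] at hn1
    rw [div_le_iff₀ hD, mul_comm] at hn2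
    refine le_trans ?_ (ENNReal.le_tsum n)
    rw [indicator_of_mem (by rw [Metric.mem_closedBall, dist_comm]; exact hn2)]
    refine ENNReal.ofReal_le_ofReal ?_
    rw [sub_eq_add_neg, Real.rpow_add hd]
    exact mul_le_mul (Real.rpow_le_rpow hd.le hn2 hε.le)
      (Real.rpow_le_rpow_of_nonpos (by positivity) hn1.le (by linarith)) (by positivity)
      (by positivity)
  calc ∫⁻ y, ENNReal.ofReal (dist x y ^ (ε - δ)) ∂μ
      ≤ ∫⁻ y, ∑' n : ℕ, (Metric.closedBall x (D * (1 / 2) ^ n)).indicator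
        (fun _ => ENNReal.ofReal (c n)) y ∂μ := lintegral_mono_ae hpt
    _ = ∑' n : ℕ, ENNReal.ofReal (c n) * μ (Metric.closedBall x (D * (1 / 2) ^ n)) := by
        rw [lintegral_tsum fun n =>
          (measurable_const.indicator measurableSet_closedBall).aemeasurable]
        simp_rw [lintegral_indicator_const measurableSet_closedBall]
    _ ≤ ∑' n : ℕ, ENNReal.ofReal (C * (1 / 2 : ℝ) ^ (-δ) * D ^ ε * ((1 / 2 : ℝ) ^ ε) ^ n) := by
        refine ENNReal.tsum_le_tsum fun n => ?_
        rw [← hcC, ENNReal.ofReal_mul (hc n)]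
        gcongr
        exact hμ x _ (by positivity)
    _ = _ := (ENNReal.ofReal_tsum_of_nonneg (fun n => by positivity) hsum).symm

/-- `t ↦ t^(-δ)` is Lipschitz on `[1/2, ∞)`. -/
lemma abs_rpow_neg_sub_one_le {δ t : ℝ} (hδ : 0 < δ) (ht : 1 / 2 ≤ t) :
    |t ^ (-δ) - 1| ≤ δ * (1 / 2 : ℝ) ^ (-δ - 1) * |t - 1| := by
  have h := (convex_Ici (1 / 2 : ℝ)).norm_image_sub_le_of_norm_deriv_le
    (f := fun s : ℝ => s ^ (-δ)) (C := δ * (1 / 2 : ℝ) ^ (-δ - 1)) (x := 1) (y := t)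
    (fun s hs => ?_) (fun s hs => ?_) (by norm_num [mem_Ici]) ht
  · simpa using h
  · have hs0 : s ≠ 0 := by have : (1 / 2 : ℝ) ≤ s := hs; linarith
    exact (Real.hasDerivAt_rpow_const (Or.inl hs0)).differentiableAt
  · have hs' : (1 / 2 : ℝ) ≤ s := hs
    have hs0 : 0 < s := by linarith
    rw [(Real.hasDerivAt_rpow_const (Or.inl hs0.ne')).deriv, norm_mul, norm_neg,
      Real.norm_of_nonneg hδ.le, Real.norm_of_nonneg (by positivity)]
    exact mul_le_mul_of_nonneg_left
      (Real.rpow_le_rpow_of_nonpos (by norm_num) hs' (by linarith)) hδ.le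

/-- For two positive reals at distance at most `r`, both at least `r`, the difference of their
`-δ`-th powers. -/
lemma abs_rpow_neg_sub_rpow_neg_le {δ γ a b r : ℝ} (hδ : 0 < δ) (hγ1 : γ ≤ 1) (hb : 0 < b)
    (hr : 0 ≤ r) (hab : |a - b| ≤ r) (hrb : r ≤ b) (hba : b ≤ 2 * a) :
    |a ^ (-δ) - b ^ (-δ)| ≤ δ * (1 / 2 : ℝ) ^ (-δ - 1) * r ^ γ * b ^ (-δ - γ) := by
  have ha : 0 < a := by linarith
  have h1 := abs_rpow_neg_sub_one_le hδ (t := a / b) (by rw [le_div_iff₀ hb]; linarith)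
  have h2 : |a / b - 1| ≤ (r / b) ^ γ := by
    -- After rescaling by `b`, `r / b ≤ 1` and `γ ≤ 1` allow a Lipschitz bound to be weakened to a
    -- `γ`-Hölder one.
    have : a / b - 1 = (a - b) / b := by field_simp
    rw [this, abs_div, abs_of_pos hb]
    refine (div_le_div_of_nonneg_right hab hb.le).trans ?_
    rcases hr.eq_or_lt with rfl | hr
    · simp only [zero_div]; positivity
    · exact Real.self_le_rpow_of_le_one (by positivity) ((div_le_one hb).2 hrb) hγ1
  have h3 : a ^ (-δ) - b ^ (-δ) = b ^ (-δ) * ((a / b) ^ (-δ) - 1) := by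
    rw [Real.div_rpow ha.le hb.le]
    have : b ^ (-δ) ≠ 0 := by positivity
    field_simp
  have h4 : b ^ (-δ - γ) = b ^ (-δ) / b ^ γ := Real.rpow_sub hb _ _
  rw [h3, abs_mul, abs_of_pos (Real.rpow_pos_of_pos hb _), h4]
  calc b ^ (-δ) * |(a / b) ^ (-δ) - 1|
      ≤ b ^ (-δ) * (δ * (1 / 2 : ℝ) ^ (-δ - 1) * (r / b) ^ γ) := by
        gcongr
        exact h1.trans (by gcongr)
    _ = _ := by rw [Real.div_rpow hr hb.le]; ring

/-- The integrand of the pointwise logarithmic Laplacian of `f`. -/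
def kernelDiff (δ : ℝ) (f : X → ℝ) (x y : X) : ℝ := (f x - f y) / dist x y ^ δ

lemma abs_kernelDiff_le {δ β K : ℝ} {f : X → ℝ}
    (hf : ∀ u v, |f u - f v| ≤ K * dist u v ^ β) {x y : X} (hxy : x ≠ y) :
    |kernelDiff δ f x y| ≤ K * dist x y ^ (β - δ) := by
  have hd : 0 < dist x y := dist_pos.2 hxy
  rw [kernelDiff, abs_div, abs_of_pos (Real.rpow_pos_of_pos hd δ), Real.rpow_sub hd,
    ← mul_div_assoc]
  gcongr
  exact hf x y

lemma kernelDiff_self (δ : ℝ) (f : X → ℝ) (x : X) : kernelDiff δ f x x = 0 := by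
  simp [kernelDiff]

/-- The Hölder exponent `γ + ε` is spent in two ways: `γ` becomes the modulus in `d(x, x')`, and `ε`
keeps what remains integrable in `y`. When `y` is far from `x` on the scale of `d(x, x')`,
cancellation between the two kernels is used; when it is near, each kernel is small enough alone. -/
lemma exists_abs_kernelDiff_sub_le {δ γ ε K : ℝ} (hδ : 0 < δ) (hγ0 : 0 < γ) (hγ1 : γ ≤ 1)
    (hε : 0 < ε) (hK : 0 ≤ K) {f : X → ℝ}
    (hf : ∀ u v, |f u - f v| ≤ K * dist u v ^ (γ + ε)) :
    ∃ M : ℝ, 0 ≤ M ∧ ∀ x x' y : X,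
      |kernelDiff δ f x y - kernelDiff δ f x' y| ≤
        M * dist x x' ^ γ * (dist x y ^ (ε - δ) + dist x' y ^ (ε - δ)) := by
  set L : ℝ := δ * (1 / 2 : ℝ) ^ (-δ - 1) with hL
  have hL0 : 0 ≤ L := by positivity
  -- `K * 3 ^ γ` serves the near case; `K` and `K * L` serve the variation of `f` and of the kernel
  -- in the far case.
  refine ⟨K * 3 ^ γ + K + K * L, by positivity, fun x x' y => ?_⟩
  rcases eq_or_ne x x' with rfl | hxx'
  · rw [sub_self, abs_zero]; positivity
  have hr : 0 < dist x x' := dist_pos.2 hxx'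
  have hab1 : dist x y ≤ dist x x' + dist x' y := dist_triangle _ _ _
  have hab2 : dist x' y ≤ dist x x' + dist x y := dist_triangle_left _ _ _
  have hR : 0 ≤ dist x x' ^ γ := by positivity
  have hP : 0 ≤ dist x y ^ (ε - δ) := by positivity
  have hQ : 0 ≤ dist x' y ^ (ε - δ) := by positivity
  have hfx := hf x x'
  have hfy := hf x' y
  -- In the far case `r ≤ b ≤ 2 * a`, as the power estimate requires. In the near case both
  -- distances to `y` are at most `3 * dist x x'`.
  rcases le_total (2 * dist x x') (dist x y) with h | h
  · simp only [kernelDiff]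
    set a := dist x y
    set b := dist x' y
    set r := dist x x'
    have ha : 0 < a := by linarith
    have hb : 0 < b := by linarith
    have h1 : |(f x - f x') * a ^ (-δ)| ≤ K * r ^ γ * a ^ (ε - δ) := by
      rw [abs_mul, abs_of_pos (Real.rpow_pos_of_pos ha _), sub_eq_add_neg ε δ, Real.rpow_add ha,
        ← mul_assoc]
      gcongr
      refine hfx.trans ?_
      rw [Real.rpow_add hr, ← mul_assoc]
      gcongr
      linarith
    have h2 : |(f x' - f y) * (a ^ (-δ) - b ^ (-δ))| ≤ K * L * r ^ γ * b ^ (ε - δ) := by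
      rw [abs_mul]
      have h3 := abs_rpow_neg_sub_rpow_neg_le hδ hγ1 hb hr.le (a := a)
        (abs_sub_le_iff.2 ⟨by linarith, by linarith⟩) (by linarith) (by linarith)
      calc |f x' - f y| * |a ^ (-δ) - b ^ (-δ)|
          ≤ (K * b ^ (γ + ε)) * (L * r ^ γ * b ^ (-δ - γ)) :=
            mul_le_mul hfy h3 (abs_nonneg _) (by positivity)
        _ = K * L * r ^ γ * (b ^ (γ + ε) * b ^ (-δ - γ)) := by ring
        _ = _ := by rw [← Real.rpow_add hb]; ring_nf
    have h4 : (f x - f y) / a ^ δ - (f x' - f y) / b ^ δ =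
        (f x - f x') * a ^ (-δ) + (f x' - f y) * (a ^ (-δ) - b ^ (-δ)) := by
      rw [Real.rpow_neg ha.le, Real.rpow_neg hb.le]; ring
    rw [h4]
    refine (abs_add_le _ _).trans ((add_le_add h1 h2).trans ?_)
    have e : (K * 3 ^ γ + K + K * L) * r ^ γ * (a ^ (ε - δ) + b ^ (ε - δ)) =
      (K * r ^ γ * a ^ (ε - δ) + K * L * r ^ γ * b ^ (ε - δ)) +
      (K * 3 ^ γ * r ^ γ * a ^ (ε - δ) + K * 3 ^ γ * r ^ γ * b ^ (ε - δ) +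
        K * r ^ γ * b ^ (ε - δ) + K * L * r ^ γ * a ^ (ε - δ)) := by ring
    rw [e]
    exact le_add_of_nonneg_right (by positivity)
  · have key : ∀ z : X, dist z y ≤ 3 * dist x x' → |kernelDiff δ f z y| ≤
        K * 3 ^ γ * dist x x' ^ γ * dist z y ^ (ε - δ) := by
      intro z hz
      rcases eq_or_ne z y with rfl | hzy
      · rw [kernelDiff_self, abs_zero]; positivity
      refine (abs_kernelDiff_le hf hzy).trans ?_
      rw [add_sub_assoc, Real.rpow_add (dist_pos.2 hzy), mul_assoc K,
        ← Real.mul_rpow (by norm_num) hr.le, mul_assoc]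
      gcongr
    refine (abs_sub _ _).trans ((add_le_add (key x (by linarith)) (key x' (by linarith))).trans ?_)
    rw [← mul_add]
    gcongr
    rw [add_assoc]
    exact le_add_of_nonneg_right (by positivity)

end Potential

/-! ### Hölder and almost Hölder functions -/

section Holder

variable {X : Type*} [MetricSpace X]

lemma memHolder_iff_exists_abs_sub_le {β : ℝ≥0} {f : X → ℝ} :
    MemHolder β f ↔ ∃ K : ℝ, 0 ≤ K ∧ ∀ x y, |f x - f y| ≤ K * dist x y ^ (β : ℝ) := by
  constructor
  · rintro ⟨K, hK⟩
    exact ⟨K, K.2, fun x y => by simpa [Real.dist_eq] using hK.dist_le x y⟩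
  · rintro ⟨K, hK0, hK⟩
    refine ⟨K.toNNReal, fun x y => ?_⟩
    rw [edist_dist, edist_dist, ENNReal.ofReal_rpow_of_nonneg dist_nonneg β.coe_nonneg,
      ← ENNReal.ofReal_coe_nnreal, Real.coe_toNNReal K hK0, ← ENNReal.ofReal_mul hK0, Real.dist_eq]
    exact ENNReal.ofReal_le_ofReal (hK x y)

lemma uniformContinuous_of_abs_sub_le {β K : ℝ} (hβ : 0 < β) (hK : 0 ≤ K) {f : X → ℝ}
    (hf : ∀ x y, |f x - f y| ≤ K * dist x y ^ β) : UniformContinuous f := by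
  obtain ⟨C, hC⟩ := memHolder_iff_exists_abs_sub_le (β := ⟨β, hβ.le⟩).2 ⟨K, hK, hf⟩
  exact hC.uniformContinuous hβ

lemma IsAlmostHolder.exists_abs_sub_le {α β : ℝ} {f : X → ℝ} (hf : IsAlmostHolder α f)
    (hβ : 0 < β) (hβα : β < α) :
    ∃ K : ℝ, 0 ≤ K ∧ ∀ x y, |f x - f y| ≤ K * dist x y ^ β :=
  memHolder_iff_exists_abs_sub_le.1 (hf.2.2 ⟨β, hβ.le⟩ hβ hβα)

lemma IsAlmostHolder.memLp [MeasurableSpace X] [BorelSpace X] [SecondCountableTopology X]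
    {μ : Measure X} [IsFiniteMeasure μ] {α : ℝ} {f : X → ℝ} (hf : IsAlmostHolder α f)
    (p : ℝ≥0∞) : MemLp f p μ := by
  obtain ⟨M, hM⟩ := hf.2.1
  exact MemLp.of_bound hf.1.continuous.aestronglyMeasurable M (ae_of_all _ hM)

/-- On a bounded space a Hölder function is almost Hölder of the same exponent. -/
lemma isAlmostHolder_of_memHolder [BoundedSpace X] {α : ℝ≥0} (hα : 0 < α) {f : X → ℝ}
    (hf : MemHolder α f) : IsAlmostHolder α f := by
  refine ⟨?_, ?_, fun β _ hβα => hf.of_le (le_of_lt (by exact_mod_cast hβα))⟩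
  · obtain ⟨C, hC⟩ := hf
    exact hC.uniformContinuous hα
  · rcases isEmpty_or_nonempty X with h | ⟨⟨x₀⟩⟩
    · exact ⟨0, fun x => (h.false x).elim⟩
    obtain ⟨K, hK0, hK⟩ := memHolder_iff_exists_abs_sub_le.1 hf
    obtain ⟨D, hD⟩ := Metric.boundedSpace_iff.1 ‹BoundedSpace X›
    refine ⟨|f x₀| + K * D ^ (α : ℝ), fun x => ?_⟩
    have h1 : |f x| ≤ |f x₀| + |f x - f x₀| := by
      have := abs_add_le (f x₀) (f x - f x₀); simpa using this
    refine h1.trans ?_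
    gcongr
    refine (hK x x₀).trans ?_
    gcongr
    exact hD x x₀

end Holder

/-! ### The singular integral on almost Hölder functions -/

section Pointwise

variable {X : Type*} [MetricSpace X] [MeasurableSpace X] [BorelSpace X]
  [SecondCountableTopology X]

/-- The potentials `∫ d(x, y)^(ε - δ) dμ(y)` with `ε > 0` are bounded uniformly in `x`. -/
def HasBoundedPotentials (μ : Measure X) (δ : ℝ) : Prop :=
  ∀ ε : ℝ, 0 < ε → ∃ A : ℝ≥0, ∀ x : X, ∫⁻ y, ENNReal.ofReal (dist x y ^ (ε - δ)) ∂μ ≤ A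

/-- The logarithmic Laplacian as a singular integral operator on functions. -/
def pointwiseLaplacian (μ : Measure X) (δ : ℝ) (f : X → ℝ) (x : X) : ℝ :=
  ∫ y, kernelDiff δ f x y ∂μ

lemma abs_kernelDiff_le_of_holder {δ β K : ℝ} (hK : 0 ≤ K) {f : X → ℝ}
    (hf : ∀ u v, |f u - f v| ≤ K * dist u v ^ β) (x y : X) :
    |kernelDiff δ f x y| ≤ K * dist x y ^ (β - δ) := by
  rcases eq_or_ne x y with rfl | hxy
  · rw [kernelDiff_self, abs_zero]; positivity
  · exact abs_kernelDiff_le hf hxy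

lemma measurable_kernelDiff {f : X → ℝ} (hf : Measurable f) (δ : ℝ) :
    Measurable fun p : X × X => kernelDiff δ f p.1 p.2 :=
  ((hf.comp measurable_fst).sub (hf.comp measurable_snd)).div (measurable_dist.pow_const δ)

variable {μ : Measure X} [IsFiniteMeasure μ] {δ : ℝ}

lemma HasBoundedPotentials.exists_integral_le (hμ : HasBoundedPotentials μ δ) {ε : ℝ}
    (hε : 0 < ε) : ∃ A : ℝ, 0 ≤ A ∧ ∀ x : X, Integrable (fun y => dist x y ^ (ε - δ)) μ ∧
      ∫ y, dist x y ^ (ε - δ) ∂μ ≤ A := by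
  obtain ⟨A, hA⟩ := hμ ε hε
  refine ⟨A, A.2, fun x => ?_⟩
  have hm : AEStronglyMeasurable (fun y => dist x y ^ (ε - δ)) μ :=
    (((measurable_const (a := x)).dist measurable_id).pow_const (ε - δ)).aestronglyMeasurable
  have h0 : 0 ≤ᵐ[μ] fun y => dist x y ^ (ε - δ) :=
    ae_of_all _ fun y => Real.rpow_nonneg dist_nonneg _
  refine ⟨⟨hm, ?_⟩, ?_⟩
  · rw [hasFiniteIntegral_iff_ofReal h0]
    exact (hA x).trans_lt ENNReal.coe_lt_top
  · rw [integral_eq_lintegral_of_nonneg_ae h0 hm]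
    exact ENNReal.toReal_le_coe_of_le_coe (hA x)

lemma integrable_kernelDiff (hμ : HasBoundedPotentials μ δ) {β K : ℝ} (hβ : 0 < β) (hK : 0 ≤ K)
    {f : X → ℝ} (hf : ∀ u v, |f u - f v| ≤ K * dist u v ^ β) (x : X) :
    Integrable (kernelDiff δ f x) μ := by
  obtain ⟨A, -, hA⟩ := hμ.exists_integral_le hβ
  have hfm := (uniformContinuous_of_abs_sub_le hβ hK hf).continuous.measurable
  exact ((hA x).1.const_mul K).mono'
    ((measurable_kernelDiff hfm δ).comp measurable_prodMk_left).aestronglyMeasurable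
    (ae_of_all _ (abs_kernelDiff_le_of_holder hK hf x))

/-- The singular integral operator loses an arbitrarily small part of the Hölder exponent. -/
lemma exists_abs_pointwiseLaplacian_sub_le (hδ : 0 < δ) (hμ : HasBoundedPotentials μ δ)
    {γ ε K : ℝ} (hγ0 : 0 < γ) (hγ1 : γ ≤ 1) (hε : 0 < ε) (hK : 0 ≤ K) {f : X → ℝ}
    (hf : ∀ u v, |f u - f v| ≤ K * dist u v ^ (γ + ε)) :
    ∃ K' : ℝ, 0 ≤ K' ∧ ∀ x x', |pointwiseLaplacian μ δ f x - pointwiseLaplacian μ δ f x'| ≤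
      K' * dist x x' ^ γ := by
  obtain ⟨M, hM0, hM⟩ := exists_abs_kernelDiff_sub_le hδ hγ0 hγ1 hε hK hf
  obtain ⟨A, hA0, hA⟩ := hμ.exists_integral_le hε
  have hi := integrable_kernelDiff hμ (add_pos hγ0 hε) hK hf
  refine ⟨M * (A + A), by positivity, fun x x' => ?_⟩
  rw [pointwiseLaplacian, pointwiseLaplacian, ← integral_sub (hi x) (hi x'), ← Real.norm_eq_abs]
  calc _ ≤ ∫ y, M * dist x x' ^ γ * (dist x y ^ (ε - δ) + dist x' y ^ (ε - δ)) ∂μ :=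
        norm_integral_le_of_norm_le (((hA x).1.add (hA x').1).const_mul _)
          (ae_of_all _ (hM x x'))
    _ = M * dist x x' ^ γ * (∫ y, dist x y ^ (ε - δ) ∂μ + ∫ y, dist x' y ^ (ε - δ) ∂μ) := by
        rw [integral_const_mul, integral_add (hA x).1 (hA x').1]
    _ ≤ M * dist x x' ^ γ * (A + A) := by
        gcongr
        exacts [(hA x).2, (hA x').2]
    _ = _ := by ring

theorem isAlmostHolder_pointwiseLaplacian (hδ : 0 < δ) (hμ : HasBoundedPotentials μ δ) {α : ℝ}
    (hα0 : 0 < α) (hα1 : α ≤ 1) {f : X → ℝ} (hf : IsAlmostHolder α f) :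
    IsAlmostHolder α (pointwiseLaplacian μ δ f) := by
  have holder : ∀ γ : ℝ, 0 < γ → γ < α → ∃ K' : ℝ, 0 ≤ K' ∧ ∀ x x',
      |pointwiseLaplacian μ δ f x - pointwiseLaplacian μ δ f x'| ≤ K' * dist x x' ^ γ := by
    intro γ hγ hγα
    -- The midpoint of `γ` and `α`: still an admissible exponent for `f`, with `(α - γ) / 2` to
    -- lose.
    obtain ⟨K, hK0, hK⟩ := hf.exists_abs_sub_le (β := γ + (α - γ) / 2) (by linarith) (by linarith)
    exact exists_abs_pointwiseLaplacian_sub_le hδ hμ hγ (by linarith) (by linarith) hK0 hK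
  refine ⟨?_, ?_, fun γ hγ hγα => memHolder_iff_exists_abs_sub_le.2 (holder γ hγ hγα)⟩
  · obtain ⟨K, hK0, hK⟩ := holder (α / 2) (by linarith) (by linarith)
    exact uniformContinuous_of_abs_sub_le (by linarith) hK0 hK
  · have hα2 : 0 < α / 2 := by linarith
    obtain ⟨K, hK0, hK⟩ := hf.exists_abs_sub_le hα2 (by linarith)
    obtain ⟨A, hA0, hA⟩ := hμ.exists_integral_le hα2
    refine ⟨K * A, fun x => ?_⟩
    rw [pointwiseLaplacian, ← Real.norm_eq_abs]
    calc _ ≤ ∫ y, K * dist x y ^ (α / 2 - δ) ∂μ :=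
          norm_integral_le_of_norm_le ((hA x).1.const_mul K)
            (ae_of_all _ (abs_kernelDiff_le_of_holder hK0 hK x))
      _ = K * ∫ y, dist x y ^ (α / 2 - δ) ∂μ := integral_const_mul _ _
      _ ≤ K * A := by gcongr; exact (hA x).2

end Pointwise

/-! ### Identification with the form operator -/

section Operator

variable {X : Type*} [MetricSpace X] [MeasurableSpace X] [BorelSpace X]
  [SecondCountableTopology X] {μ : Measure X} [IsFiniteMeasure μ] {δ : ℝ}

/-- The class in `L²` of a Hölder function belongs to the domain of the form. -/
lemma toLp_mem_formDomain (hμ : HasBoundedPotentials μ δ) {β K : ℝ} (hβ : 0 < β)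
    {f : X → ℝ} (hf : ∀ u v, |f u - f v| ≤ K * dist u v ^ β) (hf2 : MemLp f 2 μ) :
    hf2.toLp f ∈ formDomain μ δ := by
  change ∫⁻ p, ENNReal.ofReal (energyDensity δ (hf2.toLp f) p) ∂(offDiag μ) < ∞
  obtain ⟨A, hA⟩ := hμ (β + β) (by linarith)
  have hpt : ∀ᵐ p ∂(offDiag μ), ENNReal.ofReal (energyDensity δ (hf2.toLp f) p) ≤
      ENNReal.ofReal (K ^ 2) * ENNReal.ofReal (dist p.1 p.2 ^ (β + β - δ)) := by
    filter_upwards [offDiag_ae hf2.coeFn_toLp,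
      ae_restrict_mem (measurableSet_diagonal (α := X)).compl] with p hp hne
    have hd : 0 < dist p.1 p.2 := dist_pos.2 hne
    rw [← ENNReal.ofReal_mul (by positivity), energyDensity, hp.1, hp.2, Real.rpow_sub hd,
      Real.rpow_add hd, ← mul_div_assoc]
    refine ENNReal.ofReal_le_ofReal ?_
    gcongr
    calc |f p.1 - f p.2| ^ 2 ≤ (K * dist p.1 p.2 ^ β) ^ 2 := by
          gcongr
          exact hf _ _
      _ = _ := by ring
  calc _ ≤ ∫⁻ p, ENNReal.ofReal (K ^ 2) * ENNReal.ofReal (dist p.1 p.2 ^ (β + β - δ))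
        ∂(offDiag μ) := lintegral_mono_ae hpt
    _ ≤ ∫⁻ p, ENNReal.ofReal (K ^ 2) * ENNReal.ofReal (dist p.1 p.2 ^ (β + β - δ))
        ∂(μ.prod μ) := lintegral_mono' Measure.restrict_le_self le_rfl
    _ = ENNReal.ofReal (K ^ 2) * ∫⁻ p, ENNReal.ofReal (dist p.1 p.2 ^ (β + β - δ))
        ∂(μ.prod μ) := lintegral_const_mul' _ _ ENNReal.ofReal_ne_top
    _ ≤ ENNReal.ofReal (K ^ 2) * (A * μ univ) := by
        gcongr
        refine (lintegral_prod_le _).trans ((lintegral_mono hA).trans ?_)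
        rw [lintegral_const]
    _ < ∞ := ENNReal.mul_lt_top ENNReal.ofReal_lt_top
        (ENNReal.mul_lt_top ENNReal.coe_lt_top (measure_lt_top μ univ))

/-- This licenses Fubini in `energy_toLp_eq`: the inner integral of `|kernelDiff|` is at most `K *
A` uniformly in `x`, so `g ∈ L¹` suffices. -/
lemma integrable_kernelDiff_mul (hμ : HasBoundedPotentials μ δ) {β K : ℝ} (hβ : 0 < β)
    (hK : 0 ≤ K) {f : X → ℝ} (hf : ∀ u v, |f u - f v| ≤ K * dist u v ^ β) {g : X → ℝ}
    (hg : Integrable g μ) :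
    Integrable (fun p : X × X => kernelDiff δ f p.1 p.2 * g p.1) (μ.prod μ) := by
  have hfm := (uniformContinuous_of_abs_sub_le hβ hK hf).continuous.measurable
  have hm : AEStronglyMeasurable (fun p : X × X => kernelDiff δ f p.1 p.2 * g p.1)
      (μ.prod μ) :=
    (measurable_kernelDiff hfm δ).aestronglyMeasurable.mul hg.aestronglyMeasurable.comp_fst
  obtain ⟨A, hA0, hA⟩ := hμ.exists_integral_le hβ
  have hi := integrable_kernelDiff hμ hβ hK hf
  refine (integrable_prod_iff hm).2 ⟨ae_of_all _ fun x => (hi x).mul_const (g x), ?_⟩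
  refine (hg.norm.const_mul (K * A)).mono' hm.norm.integral_prod_right' (ae_of_all _ fun x => ?_)
  simp only [norm_mul]
  rw [integral_mul_const, norm_mul, norm_norm, Real.norm_of_nonneg
    (integral_nonneg fun y => norm_nonneg _)]
  gcongr
  calc ∫ y, ‖kernelDiff δ f x y‖ ∂μ ≤ ∫ y, K * dist x y ^ (β - δ) ∂μ :=
        integral_mono (hi x).norm ((hA x).1.const_mul K) (abs_kernelDiff_le_of_holder hK hf x)
    _ = K * ∫ y, dist x y ^ (β - δ) ∂μ := integral_const_mul _ _
    _ ≤ K * A := by gcongr; exact (hA x).2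

/-- On Hölder functions the form is represented by the pointwise logarithmic Laplacian. -/
lemma energy_toLp_eq (hμ : HasBoundedPotentials μ δ) {β K : ℝ} (hβ : 0 < β)
    (hK : 0 ≤ K) {f : X → ℝ} (hf : ∀ u v, |f u - f v| ≤ K * dist u v ^ β) (hf2 : MemLp f 2 μ)
    (g : Lp ℝ 2 μ) :
    energy μ δ (hf2.toLp f) g = ∫ x, pointwiseLaplacian μ δ f x * g x ∂μ := by
  have hg : Integrable g μ := (Lp.memLp g).integrable (by norm_num)
  have hi := integrable_kernelDiff_mul (δ := δ) hμ hβ hK hf hg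
  have h1 : ∫ p, formIntegrand δ (hf2.toLp f) g p ∂(offDiag μ) =
      ∫ p, formIntegrand δ f g p ∂(offDiag μ) := by
    refine integral_congr_ae ?_
    filter_upwards [offDiag_ae hf2.coeFn_toLp] with p hp
    simp only [formIntegrand]
    rw [hp.1, hp.2]
  have h2 : ∫ p, formIntegrand δ f g p ∂(offDiag μ) =
      ∫ p, formIntegrand δ f g p ∂(μ.prod μ) := by
    -- The numerator vanishes on the diagonal, so restoring it costs nothing.
    refine setIntegral_eq_integral_of_forall_compl_eq_zero fun p hp => ?_
    have hp' : p.1 = p.2 := by simpa using hp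
    simp [formIntegrand, hp']
  -- The integrand is a kernel plus its swap. Both have the same integral, which cancels the factor
  -- `1 / 2` in `energy`.
  have h3 : ∀ p : X × X, formIntegrand δ f g p =
      kernelDiff δ f p.1 p.2 * g p.1 + kernelDiff δ f p.swap.1 p.swap.2 * g p.swap.1 := by
    intro p
    simp only [formIntegrand, kernelDiff, Prod.fst_swap, Prod.snd_swap, dist_comm p.2 p.1]
    ring
  have h4 := integral_prod_swap (μ := μ) (ν := μ)
    (fun p : X × X => kernelDiff δ f p.1 p.2 * g p.1)
  have h5 := integral_add hi hi.swap
  simp only [Function.comp_apply] at h5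
  rw [energy, h1, h2, integral_congr_ae (ae_of_all _ h3), h5, h4, integral_prod _ hi]
  simp only [integral_mul_const, pointwiseLaplacian]
  ring

/-- Lipschitz functions are dense in `L²`; in particular the form is densely defined. -/
lemma dense_formDomain (hμ : HasBoundedPotentials μ δ) :
    Dense (formDomain μ δ : Set (Lp ℝ 2 μ)) := by
  rw [Submodule.dense_iff_topologicalClosure_eq_top, Submodule.topologicalClosure_eq_top_iff,
    Submodule.eq_bot_iff]
  intro v hv
  have hvi : Integrable v μ := (Lp.memLp v).integrable (by norm_num)
  refine Lp.eq_zero_iff_ae_eq_zero.2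
    (ae_eq_zero_of_forall_setIntegral_isClosed_eq_zero hvi fun F hF => ?_)
  have hr : ∀ n : ℕ, 0 < 1 / ((n : ℝ) + 1) := fun n => Nat.one_div_pos_of_nat
  -- Thickened indicators are Lipschitz, hence in the form domain and orthogonal to `v`; they
  -- decrease to the indicator of the closed set `F`, which gives `∫_F v = 0`.
  have hzero : ∀ n, ∫ x, (thickenedIndicator (hr n) F x : ℝ) * v x ∂μ = 0 := by
    intro n
    have hLip := lipschitzWith_thickenedIndicator (hr n) F
    have hbd : ∀ u w, |(thickenedIndicator (hr n) F u : ℝ) - thickenedIndicator (hr n) F w| ≤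
        ((Real.toNNReal (1 / ((n : ℝ) + 1)))⁻¹ : ℝ≥0) * dist u w ^ (1 : ℝ) := by
      intro u w
      rw [Real.rpow_one]
      exact hLip.dist_le_mul u w
    have hmem : MemLp (fun x => (thickenedIndicator (hr n) F x : ℝ)) 2 μ :=
      MemLp.of_bound (NNReal.continuous_coe.comp
        (thickenedIndicator (hr n) F).continuous).aestronglyMeasurable 1
        (ae_of_all _ fun x => by simpa using thickenedIndicator_le_one (hr n) F x)
    have hin := hv _ (toLp_mem_formDomain hμ one_pos hbd hmem)
    rw [L2.inner_def] at hin
    rw [← hin]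
    refine integral_congr_ae ?_
    filter_upwards [hmem.coeFn_toLp] with x hx
    rw [hx]
    simp [mul_comm]
  have hlim := tendsto_integral_of_dominated_convergence (fun x => ‖v x‖)
    (F := fun (n : ℕ) x => (thickenedIndicator (hr n) F x : ℝ) * v x)
    (f := F.indicator v) (μ := μ)
    (fun n => (NNReal.continuous_coe.comp
        (thickenedIndicator (hr n) F).continuous).aestronglyMeasurable.mul
        hvi.aestronglyMeasurable) hvi.norm
    (fun n => ae_of_all _ fun x => by
      rw [norm_mul]
      refine mul_le_of_le_one_left (norm_nonneg _) ?_
      simpa using thickenedIndicator_le_one (hr n) F x)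
    (ae_of_all _ fun x => by
      have h := tendsto_pi_nhds.1 (thickenedIndicator_tendsto_indicator_closure hr
        tendsto_one_div_add_atTop_nhds_zero_nat F) x
      rw [hF.closure_eq] at h
      have h' := ((NNReal.continuous_coe.tendsto _).comp h).mul_const (v x)
      by_cases hx : x ∈ F
      · simpa [hx, Function.comp_def] using h'
      · simpa [hx, Function.comp_def] using h')
  simp only [hzero] at hlim
  rw [← integral_indicator hF.measurableSet]
  exact (tendsto_nhds_unique hlim tendsto_const_nhds)

theorem toLp_mem_formGraph (hμ : HasBoundedPotentials μ δ) {β K : ℝ} (hβ : 0 < β)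
    (hK : 0 ≤ K) {f : X → ℝ} (hf : ∀ u v, |f u - f v| ≤ K * dist u v ^ β) (hf2 : MemLp f 2 μ)
    (hg2 : MemLp (pointwiseLaplacian μ δ f) 2 μ) :
    (hf2.toLp f, hg2.toLp (pointwiseLaplacian μ δ f)) ∈
      formGraph (formDomain μ δ) (energyForm μ δ) := by
  refine ⟨⟨_, toLp_mem_formDomain hμ hβ hf hf2⟩, rfl, fun g => ?_⟩
  change energy μ δ (hf2.toLp f) g = _
  rw [energy_toLp_eq hμ hβ hK hf hf2, L2.inner_def]
  refine integral_congr_ae ?_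
  filter_upwards [hg2.coeFn_toLp] with x hx
  rw [hx]
  simp [mul_comm]

/-- The logarithmic Dirichlet Laplacian acts on almost Hölder functions as the pointwise one. -/
theorem logLaplacian_toLp_eq (hμ : HasBoundedPotentials μ δ) {α : ℝ}
    (hα0 : 0 < α) {f : X → ℝ} (hf : IsAlmostHolder α f)
    (hf2 : MemLp f 2 μ) (hg2 : MemLp (pointwiseLaplacian μ δ f) 2 μ) :
    ∃ h : hf2.toLp f ∈ (logLaplacian μ δ).domain,
      logLaplacian μ δ ⟨hf2.toLp f, h⟩ = hg2.toLp (pointwiseLaplacian μ δ f) := by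
  obtain ⟨K, hK0, hK⟩ := hf.exists_abs_sub_le (β := α / 2) (by linarith) (by linarith)
  have hmem := toLp_mem_formGraph hμ (by linarith) hK0 hK hf2 hg2
  -- Density is needed here: only for a single-valued `formGraph` does membership determine the
  -- value of the operator.
  rw [← formOperator_graph _ _ (dense_formDomain hμ), LinearPMap.mem_graph_iff] at hmem
  obtain ⟨⟨u, hu⟩, rfl, h⟩ := hmem
  exact ⟨hu, h⟩

theorem toLp_mem_powDomain (hδ : 0 < δ) (hμ : HasBoundedPotentials μ δ) {α : ℝ}
    (hα0 : 0 < α) (hα1 : α ≤ 1) (n : ℕ) {f : X → ℝ} (hf : IsAlmostHolder α f) :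
    (hf.memLp 2).toLp f ∈ powDomain (logLaplacian μ δ) n := by
  induction n generalizing f with
  | zero => exact Submodule.mem_top
  | succ n ih =>
    have hg := isAlmostHolder_pointwiseLaplacian hδ hμ hα0 hα1 hf
    obtain ⟨h, he⟩ := logLaplacian_toLp_eq hμ hα0 hf (hf.memLp 2) (hg.memLp 2)
    rw [mem_powDomain_succ]
    exact ⟨h, he ▸ ih hg⟩

end Operator

/-! ### Consequences of Ahlfors regularity -/

section Ahlfors

variable {X : Type*} [MetricSpace X] [MeasurableSpace X] [BorelSpace X] {μ : Measure X}
  [IsFiniteMeasure μ] {δ : ℝ}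

/-- A space carrying a finite Ahlfors regular measure is bounded. -/
lemma IsAhlforsRegular.ediam_lt_top (hδ : 0 < δ) (hμ : IsAhlforsRegular μ δ) :
    Metric.ediam (univ : Set X) < ∞ := by
  rcases isEmpty_or_nonempty X with h | ⟨⟨x⟩⟩
  · simp [univ_eq_empty_iff.2 h]
  obtain ⟨C, hC1, hC⟩ := hμ
  by_contra htop
  rw [not_lt, top_le_iff] at htop
  have hC0 : 0 < C := by linarith
  have hreal : ∀ r : ℝ, 0 ≤ r → C⁻¹ * r ^ δ ≤ μ.real univ := fun r hr => by
    refine (ENNReal.ofReal_le_iff_le_toReal (measure_ne_top μ univ)).1 ?_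
    exact ((hC x r hr (htop ▸ ENNReal.ofReal_lt_top)).1).trans (measure_mono (subset_univ _))
  have hm : 0 ≤ C * (μ.real univ + 1) := by positivity
  -- The radius is chosen so that `C⁻¹ * r ^ δ` equals the total mass plus one.
  have := hreal ((C * (μ.real univ + 1)) ^ δ⁻¹) (by positivity)
  rw [Real.rpow_inv_rpow hm hδ.ne', inv_mul_cancel_left₀ hC0.ne'] at this
  linarith

lemma IsAhlforsRegular.boundedSpace (hδ : 0 < δ) (hμ : IsAhlforsRegular μ δ) :
    BoundedSpace X :=
  ⟨Metric.isBounded_iff_ediam_ne_top.2 (hμ.ediam_lt_top hδ).ne⟩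

lemma IsAhlforsRegular.hasBoundedPotentials (hδ : 0 < δ) (hμ : IsAhlforsRegular μ δ) :
    HasBoundedPotentials μ δ := by
  intro ε hε
  rcases subsingleton_or_nontrivial X with hX | hX
  -- With diameter `0` the regularity condition is vacuous and a point may carry mass; the integrand
  -- is `0 ^ (ε - δ) ≤ 1`.
  · refine ⟨(μ univ).toNNReal, fun x => ?_⟩
    rw [ENNReal.coe_toNNReal (measure_ne_top μ univ), ← lintegral_one]
    refine lintegral_mono fun y => ?_
    rw [Subsingleton.elim x y, dist_self, ENNReal.ofReal_le_one]
    exact Real.zero_rpow_le_one _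
  have htop := hμ.ediam_lt_top hδ
  obtain ⟨C, hC1, hC⟩ := hμ
  set D : ℝ := (Metric.ediam (univ : Set X)).toReal with hDdef
  have hDe : ENNReal.ofReal D = Metric.ediam (univ : Set X) := ENNReal.ofReal_toReal htop.ne
  have hD : 0 < D := by
    rw [← ENNReal.ofReal_pos, hDe, Metric.ediam_pos_iff]
    exact nontrivial_univ
  have hdist : ∀ x y : X, dist x y ≤ D := fun x y => by
    rw [← ENNReal.ofReal_le_ofReal_iff hD.le, hDe, ← edist_dist]
    exact Metric.edist_le_ediam_of_mem (mem_univ x) (mem_univ y)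
  -- Regularity only covers radii below the diameter `D`; the second entry of the maximum extends
  -- the upper bound to `r ≥ D` by the total mass.
  refine exists_lintegral_dist_rpow_le (C := max C (μ.real univ / D ^ δ)) hδ
    (le_max_of_le_left (by linarith)) hD (fun x r hr => ?_) hdist hε
  rcases lt_or_ge r D with h | h
  · refine (hC x r hr ?_).2.trans (ENNReal.ofReal_le_ofReal ?_)
    · rw [← hDe]; exact (ENNReal.ofReal_lt_ofReal_iff hD).2 h
    · gcongr
      exact le_max_left _ _
  · refine (measure_mono (subset_univ _)).trans ?_
    rw [← ofReal_measureReal]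
    refine ENNReal.ofReal_le_ofReal ?_
    calc μ.real univ = μ.real univ / D ^ δ * D ^ δ := by
          rw [div_mul_cancel₀ _ (Real.rpow_pos_of_pos hD δ).ne']
      _ ≤ _ := by
          gcongr
          exact le_max_right _ _

end Ahlfors

end LogLaplacian

end

theorem proposition4p12 {X : Type*} [MetricSpace X] [LocallyCompactSpace X]
    [SecondCountableTopology X] [MeasurableSpace X] [BorelSpace X]
    (μ : Measure X) [IsFiniteMeasure μ] (δ : ℝ) (hδ : 0 < δ)
    (hμ : LogLaplacian.IsAhlforsRegular μ δ) :
    -- `Δ` maps almost `α`-Hölder functions to almost `α`-Hölder functions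
    (∀ α : ℝ, 0 < α → α ≤ 1 → ∀ f : X → ℝ, LogLaplacian.IsAlmostHolder α f →
      ∃ (hf : MemLp f 2 μ) (hdom : hf.toLp f ∈ (LogLaplacian.logLaplacian μ δ).domain),
        ∃ g : X → ℝ, LogLaplacian.IsAlmostHolder α g ∧
          LogLaplacian.logLaplacian μ δ ⟨hf.toLp f, hdom⟩ =ᵐ[μ] g) ∧
    -- almost `α`-Hölder functions are `C^∞`-vectors for `Δ`
    (∀ α : ℝ, 0 < α → α ≤ 1 → ∀ f : X → ℝ, LogLaplacian.IsAlmostHolder α f →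
      ∃ hf : MemLp f 2 μ,
        hf.toLp f ∈ LogLaplacian.smoothVectors (LogLaplacian.logLaplacian μ δ)) ∧
    -- in particular, so is every Hölder continuous function
    (∀ α : ℝ≥0, 0 < α → α ≤ 1 → ∀ f : X → ℝ, MemHolder α f →
      ∃ hf : MemLp f 2 μ,
        hf.toLp f ∈ LogLaplacian.smoothVectors (LogLaplacian.logLaplacian μ δ)) := by
  have hP := hμ.hasBoundedPotentials hδ
  have := hμ.boundedSpace hδ
  have smooth : ∀ α : ℝ, 0 < α → α ≤ 1 → ∀ f : X → ℝ, LogLaplacian.IsAlmostHolder α f →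
      ∃ hf : MemLp f 2 μ,
        hf.toLp f ∈ LogLaplacian.smoothVectors (LogLaplacian.logLaplacian μ δ) := by
    intro α hα0 hα1 f hf
    refine ⟨hf.memLp 2, ?_⟩
    simp only [LogLaplacian.smoothVectors, Submodule.mem_iInf]
    exact fun n _ => LogLaplacian.toLp_mem_powDomain hδ hP hα0 hα1 n hf
  refine ⟨fun α hα0 hα1 f hf => ?_, smooth, fun α hα0 hα1 f hf =>
    smooth α hα0 hα1 f (LogLaplacian.isAlmostHolder_of_memHolder hα0 hf)⟩
  have hg := LogLaplacian.isAlmostHolder_pointwiseLaplacian hδ hP hα0 hα1 hf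
  obtain ⟨h, he⟩ := LogLaplacian.logLaplacian_toLp_eq hP hα0 hf (hf.memLp 2) (hg.memLp 2)
  refine ⟨hf.memLp 2, h, _, hg, ?_⟩
  rw [he]
  exact (hg.memLp 2).coeFn_toLp
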